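/- For $z\in\mathbb{C}$ let $[z]=\lfloor \operatorname{Re} z+\tfrac12\rfloor+i\lfloor \operatorname{Im} z+\tfrac12\rfloor$ be the nearest Gaussian integer, let $\mathfrak{F}=\{z\in\mathbb{C}:[z]=0\}$, and let $T:\mathfrak{F}\to\mathfrak{F}$ be given by $T(0)=0$ and $T(z)=z^{-1}-[z^{-1}]$ for $z\neq 0$. For $z\in\mathfrak{F}$ and $n\ge 1$ with $T^{n-1}(z)\neq 0$, the $n$-th partial quotient of the Hurwitz continued fraction of $z$ is $a_n(z)=[1/T^{n-1}(z)]$; otherwise $a_n(z)$ does not exist. Write $\|z\|=\max\{|\operatorname{Re} z|,|\operatorname{Im} z|\}$, let $|z|$ be the complex absolute value, and let $\dim_H$ denote Hausdorff dimension in $\mathbb{C}$ with the Euclidean metric. **Theorem (complex Łuczak theorem).** Let $b,c>1$ be real numbers. The set of all $z\in\mathfrak{F}$ such that $a_n(z)$ exists and $|a_n(z)|\ge c^{b^n}$ for all $n\ge1$, and the set of all $z\in\mathfrak{F}$ such that $a_n(z)$ exists and $|a_n(z)|\ge c^{b^n}$ for infinitely many $n\ge 1$, both have Hausdorff dimension $$\frac{2}{1+b}.$$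 The two sets defined in the same way with $\|a_n(z)\|$ in place of $|a_n(z)|$ also both have Hausdorff dimension $\frac{2}{1+b}$. -/

import Mathlib

namespace HurwitzCF

noncomputable section

/-- The nearest Gaussian integer `[z] = ⌊Re z + 1/2⌋ + i ⌊Im z + 1/2⌋`. -/
def nearest (z : ℂ) : GaussianInt :=
  ⟨⌊z.re + 1 / 2⌋, ⌊z.im + 1 / 2⌋⟩

/-- The half-open unit square `𝔉 = {z : [z] = 0}` centred at the origin. -/
def fundamentalSquare : Set ℂ :=
  {z | nearest z = 0}

/-- The complex Gauss map: `T z = z⁻¹ - [z⁻¹]` for `z ≠ 0`, and `T 0 = 0`. -/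
def gaussMap (z : ℂ) : ℂ :=
  if z = 0 then 0 else z⁻¹ - GaussianInt.toComplex (nearest z⁻¹)

theorem mem_fundamentalSquare_iff (z : ℂ) :
    z ∈ fundamentalSquare ↔
      (-(1 / 2) ≤ z.re ∧ z.re < 1 / 2) ∧ (-(1 / 2) ≤ z.im ∧ z.im < 1 / 2) := by
  simp only [fundamentalSquare, nearest, Set.mem_ofPred_eq, Zsqrtd.ext_iff, Zsqrtd.re_zero,
    Zsqrtd.im_zero, Int.floor_eq_zero_iff, Set.mem_Ico]
  constructor
  · rintro ⟨⟨h1, h2⟩, h3, h4⟩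
    exact ⟨⟨by linarith, by linarith⟩, by linarith, by linarith⟩
  · rintro ⟨⟨h1, h2⟩, h3, h4⟩
    exact ⟨⟨by linarith, by linarith⟩, by linarith, by linarith⟩

/-- The Gauss map takes its values in the square `𝔉`. -/
theorem gaussMap_mem_fundamentalSquare (z : ℂ) : gaussMap z ∈ fundamentalSquare := by
  rw [mem_fundamentalSquare_iff]
  unfold gaussMap
  split_ifs
  · norm_num
  · have h1 := Int.floor_le (z⁻¹.re + 1 / 2)
    have h2 := Int.lt_floor_add_one (z⁻¹.re + 1 / 2)
    have h3 := Int.floor_le (z⁻¹.im + 1 / 2)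
    have h4 := Int.lt_floor_add_one (z⁻¹.im + 1 / 2)
    simp only [Complex.sub_re, Complex.sub_im, ← GaussianInt.intCast_re,
      ← GaussianInt.intCast_im, nearest]
    exact ⟨⟨by linarith, by linarith⟩, by linarith, by linarith⟩

/-- The Hurwitz continued fraction of `z` has an `n`-th partial quotient (`n ≥ 1`), that is,
`T^(n-1) z ≠ 0`. -/
def HasPartialQuotient (z : ℂ) (n : ℕ) : Prop :=
  1 ≤ n ∧ gaussMap^[n - 1] z ≠ 0

/-- The `n`-th partial quotient `a_n(z) = [(T^(n-1) z)⁻¹]`; it is meaningful when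
`HasPartialQuotient z n` holds. -/
def partialQuotient (z : ℂ) (n : ℕ) : GaussianInt :=
  nearest (gaussMap^[n - 1] z)⁻¹

/-- The norm `max {|Re z|, |Im z|}` on `ℂ`. -/
def supNorm (z : ℂ) : ℝ :=
  max |z.re| |z.im|

/-- Those `z ∈ 𝔉` for which, for every `n ≥ 1`, the partial quotient `a_n(z)` exists and
`c ^ (b ^ n) ≤ |a_n(z)|`, where `|·|` is measured by `N`. -/
def luczakAll (N : ℂ → ℝ) (b c : ℝ) : Set ℂ :=
  {z | z ∈ fundamentalSquare ∧ ∀ n : ℕ, 1 ≤ n →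
    HasPartialQuotient z n ∧
      c ^ (b ^ n) ≤ N (GaussianInt.toComplex (partialQuotient z n))}

/-- Those `z ∈ 𝔉` for which there are infinitely many `n ≥ 1` such that the partial quotient
`a_n(z)` exists and `c ^ (b ^ n) ≤ |a_n(z)|`, where `|·|` is measured by `N`. -/
def luczakInfinitelyOften (N : ℂ → ℝ) (b c : ℝ) : Set ℂ :=
  {z | z ∈ fundamentalSquare ∧ {n : ℕ | HasPartialQuotient z n ∧
    c ^ (b ^ n) ≤ N (GaussianInt.toComplex (partialQuotient z n))}.Infinite}

end

end HurwitzCF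

namespace HurwitzCF

noncomputable section

/-! The all-n set for `supNorm` is the smallest of the four sets and the infinitely-often set for
the Euclidean norm is the largest, so a lower bound for the first and an upper bound for the second
suffice. Both rest on one identity: if two expansions share their first n digits, their distance is
the distance of the n-th remainders times the product of all earlier remainders. Each remainder is
comparable to the inverse of its digit, so no convergents are needed.

Lower bound: a mixed radix expansion of a point of the unit square is fed into digits of size A_k ≍
c^(b^(k+1)). By `exists_map_unitSquare` and `exists_rpow_prod_le`, the inverse of this coding is
Hölder with any exponent t < 1/(1+b). The square has dimension 2, so the image has dimension at
least 2t.

Upper bound: let P_n be the product of the moduli of the first n digits, and let 1 < β < b. If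
digits exceed c^(b^n) infinitely often, `exists_record` gives infinitely many n with P_(n+1) ≥ P_n^β
and P_(n+1) ≥ exp(β^(n+1)). For γ < β the points with such a record after given first n digits form
a set of diameter at most 8·16^n·P_n^(-(1+γ)) times a doubly exponentially small factor. If (1+γ)s >
2, the sum of s-th powers over all digit strings is an n-th power of a convergent lattice sum, which
that factor beats. Letting γ approach b gives every s > 2/(1+b). -/

/-! ### Geometry of one step of the expansion -/

theorem norm_le_of_mem_fundamentalSquare {z : ℂ} (hz : z ∈ fundamentalSquare) : ‖z‖ ≤ 3 / 4 := by
  obtain ⟨⟨h1, h2⟩, h3, h4⟩ := (mem_fundamentalSquare_iff z).1 hz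
  refine abs_le_of_sq_le_sq' ?_ (by norm_num) |>.2
  rw [← Complex.normSq_eq_norm_sq, Complex.normSq_apply]
  nlinarith

theorem mem_fundamentalSquare_of_norm_le {z : ℂ} (hz : ‖z‖ ≤ 1 / 4) : z ∈ fundamentalSquare := by
  have h1 := abs_le.1 ((Complex.abs_re_le_norm z).trans hz)
  have h2 := abs_le.1 ((Complex.abs_im_le_norm z).trans hz)
  rw [mem_fundamentalSquare_iff]
  exact ⟨⟨by linarith, by linarith⟩, by linarith, by linarith⟩

theorem nearest_toComplex_add (a : GaussianInt) {w : ℂ} (hw : w ∈ fundamentalSquare) :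
    nearest (GaussianInt.toComplex a + w) = a := by
  obtain ⟨⟨h1, h2⟩, h3, h4⟩ := (mem_fundamentalSquare_iff w).1 hw
  ext
  · simp only [nearest, Complex.add_re, ← GaussianInt.intCast_re]
    rw [Int.floor_eq_iff]
    constructor <;> linarith
  · simp only [nearest, Complex.add_im, ← GaussianInt.intCast_im]
    rw [Int.floor_eq_iff]
    constructor <;> linarith

theorem inv_eq_nearest_add_gaussMap {z : ℂ} (hz : z ≠ 0) :
    z⁻¹ = GaussianInt.toComplex (nearest z⁻¹) + gaussMap z := by
  simp [gaussMap, hz]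

theorem one_le_norm_toComplex {a : GaussianInt} (ha : a ≠ 0) :
    1 ≤ ‖GaussianInt.toComplex a‖ := by
  have h : (1 : ℤ) ≤ a.norm := GaussianInt.norm_pos.2 ha
  have h' : (1 : ℝ) ≤ (a.norm : ℝ) := by exact_mod_cast h
  rw [GaussianInt.intCast_real_norm, Complex.normSq_eq_norm_sq] at h'
  nlinarith [norm_nonneg (GaussianInt.toComplex a)]

theorem supNorm_le_norm (z : ℂ) : supNorm z ≤ ‖z‖ :=
  max_le (Complex.abs_re_le_norm z) (Complex.abs_im_le_norm z)

/-- One step of the expansion changes distances by the factor `‖x‖ * ‖y‖`. -/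
theorem norm_sub_eq_of_inv_eq {x y s t : ℂ} (hx : x ≠ 0) (hy : y ≠ 0) (hs : x⁻¹ = s)
    (ht : y⁻¹ = t) : ‖x - y‖ = ‖s - t‖ * (‖x‖ * ‖y‖) := by
  subst hs ht
  rw [← norm_mul, ← norm_mul, ← norm_neg]
  congr 1
  field_simp
  ring

/-- Two expansions with the same first `n` digits. -/
theorem norm_sub_eq_mul_prod {x y a : ℕ → ℂ} {n : ℕ} (hx : ∀ k < n, x k ≠ 0)
    (hy : ∀ k < n, y k ≠ 0) (hxa : ∀ k < n, (x k)⁻¹ = a k + x (k + 1))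
    (hya : ∀ k < n, (y k)⁻¹ = a k + y (k + 1)) :
    ‖x 0 - y 0‖ = ‖x n - y n‖ * ∏ k ∈ Finset.range n, (‖x k‖ * ‖y k‖) := by
  induction n with
  | zero => simp
  | succ n ih =>
    rw [ih (fun k hk => hx k (by omega)) (fun k hk => hy k (by omega))
      (fun k hk => hxa k (by omega)) (fun k hk => hya k (by omega)), Finset.prod_range_succ,
      norm_sub_eq_of_inv_eq (hx n (by omega)) (hy n (by omega)) (hxa n (by omega))
      (hya n (by omega)), add_sub_add_left_eq_sub]
    ring

/-! ### Continued fractions with prescribed large digits -/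

theorem norm_inv_add_le {a w : ℂ} (ha : 5 ≤ ‖a‖) (hw : ‖w‖ ≤ 1 / 4) :
    a + w ≠ 0 ∧ ‖(a + w)⁻¹‖ ≤ 1 / 4 := by
  have h : 4 ≤ ‖a + w‖ := by
    have := norm_sub_le (a + w) w
    rw [add_sub_cancel_right] at this
    linarith
  refine ⟨fun h0 => ?_, ?_⟩
  · rw [h0, norm_zero] at h
    linarith
  · rw [norm_inv, one_div]
    exact inv_anti₀ (by norm_num) h

/-- Truncated fractions converge geometrically: each further step multiplies distances by two
factors of modulus at most 1/4. All tails are constructed together, so that the recursion passes to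
the limit. -/
theorem exists_inv_eq_add {a : ℕ → ℂ} (ha : ∀ k, 5 ≤ ‖a k‖) :
    ∃ x : ℕ → ℂ, ∀ k, ‖x k‖ ≤ 1 / 4 ∧ x k ≠ 0 ∧ (x k)⁻¹ = a k + x (k + 1) := by
  -- `F m k` is the fraction with digits a k, ..., a (k + m - 1), truncated with remainder 0.
  let F : ℕ → ℕ → ℂ := fun m => Nat.rec (fun _ => 0) (fun _ f k => (a k + f (k + 1))⁻¹) m
  have F0 : ∀ k, F 0 k = 0 := fun _ => rfl
  have Fs : ∀ m k, F (m + 1) k = (a k + F m (k + 1))⁻¹ := fun _ _ => rfl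
  have hF : ∀ m k, ‖F m k‖ ≤ 1 / 4 := by
    intro m
    induction m with
    | zero => intro k; simp [F0]
    | succ m ih => intro k; rw [Fs]; exact (norm_inv_add_le (ha k) (ih _)).2
  have hd : ∀ m k, dist (F m k) (F (m + 1) k) ≤ 1 / 4 * (1 / 16) ^ m := by
    intro m
    induction m with
    | zero => intro k; rw [F0, dist_zero_left]; simpa using hF 1 k
    | succ m ih =>
      intro k
      have h1 := norm_inv_add_le (ha k) (hF m (k + 1))
      have h2 := norm_inv_add_le (ha k) (hF (m + 1) (k + 1))
      rw [Fs m, Fs (m + 1), dist_eq_norm, norm_sub_eq_of_inv_eq (inv_ne_zero h1.1)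
        (inv_ne_zero h2.1) (inv_inv _) (inv_inv _), add_sub_add_left_eq_sub, ← dist_eq_norm]
      refine (mul_le_mul (ih _) (mul_le_mul h1.2 h2.2 (by positivity) (by norm_num))
        (by positivity) (by positivity)).trans_eq ?_
      ring
  have hlim : ∀ k, ∃ l, Filter.Tendsto (fun m => F m k) Filter.atTop (nhds l) := fun k =>
    cauchySeq_tendsto_of_complete (cauchySeq_of_le_geometric (1 / 16) (1 / 4) (by norm_num)
      fun m => hd m k)
  choose x hx using hlim
  have hx4 : ∀ k, ‖x k‖ ≤ 1 / 4 := fun k =>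
    le_of_tendsto (hx k).norm (Filter.Eventually.of_forall fun m => hF m k)
  have heq : ∀ k, x k = (a k + x (k + 1))⁻¹ := by
    intro k
    refine tendsto_nhds_unique ((Filter.tendsto_add_atTop_iff_nat 1).2 (hx k)) ?_
    exact (tendsto_const_nhds.add (hx (k + 1))).inv₀ (norm_inv_add_le (ha k) (hx4 _)).1
  refine ⟨x, fun k => ⟨hx4 k, ?_, ?_⟩⟩
  · rw [heq]
    exact inv_ne_zero (norm_inv_add_le (ha k) (hx4 _)).1
  · conv_lhs => rw [heq]
    rw [inv_inv]

theorem gaussMap_eq {a : GaussianInt} {x w : ℂ} (hx : x ≠ 0)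
    (h : x⁻¹ = GaussianInt.toComplex a + w) (hw : w ∈ fundamentalSquare) : gaussMap x = w := by
  rw [gaussMap, if_neg hx, h, nearest_toComplex_add a hw, add_sub_cancel_left]

/-! ### Expansions of points of the unit square in a mixed Gaussian radix -/

/-- The Gaussian integer below `z`, coordinatewise. -/
def gaussFloor (z : ℂ) : GaussianInt :=
  ⟨⌊z.re⌋, ⌊z.im⌋⟩

/-- The half-open unit square. -/
def unitSquare : Set ℂ :=
  {z | (0 ≤ z.re ∧ z.re < 1) ∧ 0 ≤ z.im ∧ z.im < 1}

/-- The remainders of the mixed radix expansion of `u` with radices `A k`. -/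
def radixRem (A : ℕ → ℕ) (u : ℂ) : ℕ → ℂ
  | 0 => u
  | k + 1 => A k * radixRem A u k - GaussianInt.toComplex (gaussFloor (A k * radixRem A u k))

/-- The digits of the mixed radix expansion of `u` with radices `A k`. -/
def radixDigit (A : ℕ → ℕ) (u : ℂ) (k : ℕ) : GaussianInt :=
  gaussFloor (A k * radixRem A u k)

theorem radixRem_mem (A : ℕ → ℕ) {u : ℂ} (hu : u ∈ unitSquare) (k : ℕ) :
    radixRem A u k ∈ unitSquare := by
  cases k with
  | zero => exact hu
  | succ k =>
    generalize h : (A k : ℂ) * radixRem A u k = z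
    simp only [radixRem, h, unitSquare, Set.mem_ofPred_eq, Complex.sub_re, Complex.sub_im,
      ← GaussianInt.intCast_re, ← GaussianInt.intCast_im, gaussFloor]
    have h1 := Int.floor_le z.re
    have h2 := Int.lt_floor_add_one z.re
    have h3 := Int.floor_le z.im
    have h4 := Int.lt_floor_add_one z.im
    exact ⟨⟨by linarith, by linarith⟩, by linarith, by linarith⟩

theorem norm_sub_le_of_mem_unitSquare {u v : ℂ} (hu : u ∈ unitSquare) (hv : v ∈ unitSquare) :
    ‖u - v‖ ≤ 2 := by
  obtain ⟨⟨h1, h2⟩, h3, h4⟩ := hu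
  obtain ⟨⟨h5, h6⟩, h7, h8⟩ := hv
  refine (Complex.norm_le_abs_re_add_abs_im _).trans ?_
  rw [Complex.sub_re, Complex.sub_im]
  have := abs_le.2 (show -1 ≤ u.re - v.re ∧ u.re - v.re ≤ 1 from ⟨by linarith, by linarith⟩)
  have := abs_le.2 (show -1 ≤ u.im - v.im ∧ u.im - v.im ≤ 1 from ⟨by linarith, by linarith⟩)
  linarith

theorem radixDigit_bounds {A : ℕ → ℕ} {u : ℂ} (hu : u ∈ unitSquare) (k : ℕ) :
    (0 ≤ (radixDigit A u k).re ∧ (radixDigit A u k).re ≤ A k) ∧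
      0 ≤ (radixDigit A u k).im ∧ (radixDigit A u k).im ≤ A k := by
  obtain ⟨⟨h1, h2⟩, h3, h4⟩ := radixRem_mem A hu k
  have hA : (0 : ℝ) ≤ A k := Nat.cast_nonneg _
  have key : ∀ r : ℝ, 0 ≤ r → r < 1 → 0 ≤ ⌊(A k : ℝ) * r⌋ ∧ ⌊(A k : ℝ) * r⌋ ≤ (A k : ℤ) := by
    intro r h0 h1
    refine ⟨Int.floor_nonneg.2 (by positivity), ?_⟩
    have := Int.floor_le ((A k : ℝ) * r)
    have h : (⌊(A k : ℝ) * r⌋ : ℝ) ≤ ((A k : ℤ) : ℝ) := by push_cast; nlinarith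
    exact_mod_cast h
  simp only [radixDigit, gaussFloor, Complex.mul_re, Complex.mul_im, Complex.natCast_re,
    Complex.natCast_im, zero_mul, sub_zero, add_zero]
  exact ⟨key _ h1 h2, key _ h3 h4⟩

/-- A common digit cancels, so each step just scales the difference by its radix. -/
theorem norm_sub_eq_of_radixDigit_eq {A : ℕ → ℕ} {u v : ℂ} {n : ℕ}
    (h : ∀ k < n, radixDigit A u k = radixDigit A v k) :
    ‖u - v‖ * ∏ k ∈ Finset.range n, (A k : ℝ) = ‖radixRem A u n - radixRem A v n‖ := by
  induction n with
  | zero => simp [radixRem]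
  | succ n ih =>
    rw [Finset.prod_range_succ, ← mul_assoc, ih fun k hk => h k (by omega)]
    have := h n (by omega)
    rw [radixDigit, radixDigit] at this
    rw [radixRem, radixRem, this, sub_sub_sub_cancel_right, ← mul_sub, norm_mul,
      Complex.norm_natCast, mul_comm]

theorem exists_radixDigit_ne {A : ℕ → ℕ} (hA : ∀ k, 2 ≤ A k) {u v : ℂ} (hu : u ∈ unitSquare)
    (hv : v ∈ unitSquare) (huv : u ≠ v) : ∃ n, radixDigit A u n ≠ radixDigit A v n := by
  by_contra! h
  have hpos : 0 < ‖u - v‖ := norm_pos_iff.2 (sub_ne_zero.2 huv)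
  obtain ⟨n, hn⟩ := pow_unbounded_of_one_lt (2 / ‖u - v‖) (one_lt_two : (1 : ℝ) < 2)
  have h1 := norm_sub_eq_of_radixDigit_eq (A := A) (n := n) fun k _ => h k
  have h2 := norm_sub_le_of_mem_unitSquare (radixRem_mem A hu n) (radixRem_mem A hv n)
  have h3 : (2 : ℝ) ^ n ≤ ∏ k ∈ Finset.range n, (A k : ℝ) := by
    rw [← Finset.card_range n, ← Finset.prod_const, Finset.card_range]
    exact Finset.prod_le_prod (fun _ _ => by norm_num) fun k _ => by exact_mod_cast hA k
  rw [div_lt_iff₀ hpos] at hn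
  nlinarith

theorem norm_radixDigit_sub_le {A : ℕ → ℕ} {u v : ℂ} (hu : u ∈ unitSquare) (hv : v ∈ unitSquare)
    (n : ℕ) :
    ‖GaussianInt.toComplex (radixDigit A u n) - GaussianInt.toComplex (radixDigit A v n)‖
      ≤ 2 * A n := by
  obtain ⟨⟨h1, h2⟩, h3, h4⟩ := radixDigit_bounds (A := A) hu n
  obtain ⟨⟨h5, h6⟩, h7, h8⟩ := radixDigit_bounds (A := A) hv n
  refine (Complex.norm_le_abs_re_add_abs_im _).trans ?_
  rw [Complex.sub_re, Complex.sub_im, ← GaussianInt.intCast_re, ← GaussianInt.intCast_re,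
    ← GaussianInt.intCast_im, ← GaussianInt.intCast_im]
  have a1 : |(radixDigit A u n).re - (radixDigit A v n).re| ≤ (A n : ℤ) :=
    abs_le.2 ⟨by omega, by omega⟩
  have a2 : |(radixDigit A u n).im - (radixDigit A v n).im| ≤ (A n : ℤ) :=
    abs_le.2 ⟨by omega, by omega⟩
  have a3 : |((radixDigit A u n).re : ℝ) - (radixDigit A v n).re| ≤ (A n : ℝ) := by
    exact_mod_cast a1
  have a4 : |((radixDigit A u n).im : ℝ) - (radixDigit A v n).im| ≤ (A n : ℝ) := by
    exact_mod_cast a2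
  linarith

/-- The distance of two points whose radix digits first differ at place `n`. -/
theorem norm_sub_le_of_radixDigit_ne {A : ℕ → ℕ} {u v : ℂ}
    (hu : u ∈ unitSquare) (hv : v ∈ unitSquare) {n : ℕ}
    (h : ∀ k < n, radixDigit A u k = radixDigit A v k) (hn : radixDigit A u n ≠ radixDigit A v n) :
    ‖u - v‖ * ∏ k ∈ Finset.range (n + 1), (A k : ℝ) ≤
      3 * ‖GaussianInt.toComplex (radixDigit A u n) - GaussianInt.toComplex (radixDigit A v n)‖ := by
  rw [Finset.prod_range_succ, ← mul_assoc, norm_sub_eq_of_radixDigit_eq h]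
  have h1 : 1 ≤ ‖GaussianInt.toComplex (radixDigit A u n) -
      GaussianInt.toComplex (radixDigit A v n)‖ := by
    rw [← map_sub]
    exact one_le_norm_toComplex (sub_ne_zero.2 hn)
  have h2 := norm_sub_le_of_mem_unitSquare (radixRem_mem A hu (n + 1)) (radixRem_mem A hv (n + 1))
  have h3 : (radixRem A u n - radixRem A v n) * (A n : ℂ) =
      (GaussianInt.toComplex (radixDigit A u n) - GaussianInt.toComplex (radixDigit A v n)) +
      (radixRem A u (n + 1) - radixRem A v (n + 1)) := by
    simp only [radixRem, radixDigit]
    ring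
  have h4 : ‖radixRem A u n - radixRem A v n‖ * (A n : ℝ) =
      ‖(radixRem A u n - radixRem A v n) * (A n : ℂ)‖ := by
    rw [norm_mul, Complex.norm_natCast]
  rw [h4, h3]
  -- The remainders differ by at most 2, hence by at most twice the digit difference, whose norm is
  -- at least 1; this gives the factor 3.
  refine (norm_add_le _ _).trans ?_
  linarith

/-- Points of the unit square give continued fractions whose `n`-th digit has size `A n`; the
distances of the two points and of the two continued fractions are controlled by the size `δ` of
the first difference of digits. -/
theorem exists_map_unitSquare {A : ℕ → ℕ} (hA : ∀ k, 8 ≤ A k) :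
    ∃ g : ℂ → ℂ, (∀ u ∈ unitSquare, g u ∈ fundamentalSquare ∧ ∀ n,
      HasPartialQuotient (g u) (n + 1) ∧
        (A n : ℝ) ≤ supNorm (GaussianInt.toComplex (partialQuotient (g u) (n + 1)))) ∧
    ∀ u ∈ unitSquare, ∀ v ∈ unitSquare, u ≠ v → ∃ (n : ℕ) (δ : ℝ), 0 < δ ∧ δ ≤ 2 * A n ∧
      ‖u - v‖ * ∏ k ∈ Finset.range (n + 1), (A k : ℝ) ≤ 3 * δ ∧
      δ ≤ 2 * (‖g u - g v‖ * ∏ k ∈ Finset.range (n + 1), (25 * (A k : ℝ) ^ 2)) := by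
  have hA' : ∀ k, (8 : ℝ) ≤ A k := fun k => by exact_mod_cast hA k
  -- The shift by A k in both coordinates puts them in [A k, 2 A k], so every digit has size
  -- comparable to A k, whatever the radix digit.
  let a : ℂ → ℕ → GaussianInt := fun u k => ⟨A k, A k⟩ + radixDigit A u k
  have hre : ∀ u ∈ unitSquare, ∀ k, (A k : ℝ) ≤ (GaussianInt.toComplex (a u k)).re ∧
      (GaussianInt.toComplex (a u k)).re ≤ 2 * A k := by
    intro u hu k
    obtain ⟨⟨h1, h2⟩, h3, h4⟩ := radixDigit_bounds (A := A) hu k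
    rw [← GaussianInt.intCast_re]
    have h5 : (a u k).re = A k + (radixDigit A u k).re := rfl
    constructor <;> norm_cast <;> omega
  have him : ∀ u ∈ unitSquare, ∀ k, (A k : ℝ) ≤ (GaussianInt.toComplex (a u k)).im ∧
      (GaussianInt.toComplex (a u k)).im ≤ 2 * A k := by
    intro u hu k
    obtain ⟨⟨h1, h2⟩, h3, h4⟩ := radixDigit_bounds (A := A) hu k
    rw [← GaussianInt.intCast_im]
    have h5 : (a u k).im = A k + (radixDigit A u k).im := rfl
    constructor <;> norm_cast <;> omega
  have hlow : ∀ u ∈ unitSquare, ∀ k, (A k : ℝ) ≤ supNorm (GaussianInt.toComplex (a u k)) :=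
    fun u hu k => (hre u hu k).1.trans ((le_abs_self _).trans (le_max_left _ _))
  have hup : ∀ u ∈ unitSquare, ∀ k, ‖GaussianInt.toComplex (a u k)‖ ≤ 4 * A k := by
    intro u hu k
    refine (Complex.norm_le_abs_re_add_abs_im _).trans ?_
    have h1 := hre u hu k
    have h2 := him u hu k
    have h3 := hA' k
    rw [abs_of_nonneg (by linarith), abs_of_nonneg (by linarith)]
    linarith
  have hex : ∀ u, ∃ x : ℕ → ℂ, u ∈ unitSquare → ∀ k, ‖x k‖ ≤ 1 / 4 ∧ x k ≠ 0 ∧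
      (x k)⁻¹ = GaussianInt.toComplex (a u k) + x (k + 1) := by
    intro u
    by_cases hu : u ∈ unitSquare
    · obtain ⟨x, hx⟩ := exists_inv_eq_add (a := fun k => GaussianInt.toComplex (a u k))
        fun k => by linarith [hA' k, hlow u hu k, supNorm_le_norm (GaussianInt.toComplex (a u k))]
      exact ⟨x, fun _ => hx⟩
    · exact ⟨0, fun h => absurd h hu⟩
  choose x hx using hex
  have hiter : ∀ u ∈ unitSquare, ∀ n, gaussMap^[n] (x u 0) = x u n := by
    intro u hu n
    induction n with
    | zero => rfl
    | succ n ih =>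
      rw [Function.iterate_succ_apply', ih]
      exact gaussMap_eq (hx u hu n).2.1 (hx u hu n).2.2
        (mem_fundamentalSquare_of_norm_le (hx u hu (n + 1)).1)
  have hxlow : ∀ u ∈ unitSquare, ∀ k, 1 ≤ ‖x u k‖ * (5 * A k) := by
    intro u hu k
    obtain ⟨h1, h2, h3⟩ := hx u hu k
    have h4 : ‖(x u k)⁻¹‖ ≤ 5 * A k := by
      rw [h3]
      refine (norm_add_le _ _).trans ?_
      linarith [hup u hu k, (hx u hu (k + 1)).1, hA' k]
    calc (1 : ℝ) = ‖x u k‖ * ‖(x u k)⁻¹‖ := by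
          rw [← norm_mul, mul_inv_cancel₀ h2, norm_one]
      _ ≤ _ := by gcongr
  refine ⟨fun u => x u 0, fun u hu => ⟨mem_fundamentalSquare_of_norm_le (hx u hu 0).1, fun n => ?_⟩,
    fun u hu v hv huv => ?_⟩
  · refine ⟨⟨by omega, ?_⟩, ?_⟩
    · rw [Nat.add_sub_cancel, hiter u hu]
      exact (hx u hu n).2.1
    · rw [partialQuotient, Nat.add_sub_cancel, hiter u hu, (hx u hu n).2.2,
        nearest_toComplex_add _ (mem_fundamentalSquare_of_norm_le (hx u hu (n + 1)).1)]
      exact hlow u hu n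
  · have hne := exists_radixDigit_ne (fun k => (by omega : 2 ≤ 8).trans (hA k)) hu hv huv
    classical
    let n := Nat.find hne
    have hn : radixDigit A u n ≠ radixDigit A v n := Nat.find_spec hne
    have hlt : ∀ k < n, radixDigit A u k = radixDigit A v k := fun k hk =>
      not_not.1 (Nat.find_min hne hk)
    set d := GaussianInt.toComplex (radixDigit A u n) - GaussianInt.toComplex (radixDigit A v n)
      with hd
    have hd1 : 1 ≤ ‖d‖ := by
      rw [hd, ← map_sub]
      exact one_le_norm_toComplex (sub_ne_zero.2 hn)
    refine ⟨n, ‖d‖, by linarith, norm_radixDigit_sub_le hu hv n,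
      norm_sub_le_of_radixDigit_ne hu hv hlt hn, ?_⟩
    have e1 := norm_sub_eq_mul_prod (x := x u) (y := x v) (n := n)
      (a := fun k => GaussianInt.toComplex (a u k))
      (fun k _ => (hx u hu k).2.1) (fun k _ => (hx v hv k).2.1) (fun k _ => (hx u hu k).2.2)
      (fun k hk => by rw [(hx v hv k).2.2]; simp only [a, hlt k hk])
    have e2 := norm_sub_eq_of_inv_eq (hx u hu n).2.1 (hx v hv n).2.1 (hx u hu n).2.2
      (hx v hv n).2.2
    have e3 : GaussianInt.toComplex (a u n) + x u (n + 1) -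
        (GaussianInt.toComplex (a v n) + x v (n + 1)) = d - (x v (n + 1) - x u (n + 1)) := by
      simp only [a, map_add, hd]
      ring
    rw [e3] at e2
    rw [e1, e2, mul_assoc ‖d - _‖, mul_comm (‖x u n‖ * _), ← Finset.prod_range_succ, mul_assoc,
      ← Finset.prod_mul_distrib]
    -- Each remainder is at least 1 / (5 A k), whence the factors 25 (A k)².
    have h1 : 1 ≤ ∏ k ∈ Finset.range (n + 1), ‖x u k‖ * ‖x v k‖ * (25 * (A k : ℝ) ^ 2) := by
      refine Finset.one_le_prod fun k _ => ?_
      nlinarith [mul_le_mul (hxlow u hu k) (hxlow v hv k) zero_le_one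
        (zero_le_one.trans (hxlow u hu k))]
    -- The next remainders move d by at most 1/2, and ‖d‖ ≥ 1.
    have h2 : ‖d‖ / 2 ≤ ‖d - (x v (n + 1) - x u (n + 1))‖ := by
      have := norm_sub_norm_le d (x v (n + 1) - x u (n + 1))
      have := norm_sub_le (x v (n + 1)) (x u (n + 1))
      linarith [(hx u hu (n + 1)).1, (hx v hv (n + 1)).1]
    nlinarith [norm_nonneg (d - (x v (n + 1) - x u (n + 1)))]

/-! ### Hölder exponent of the coding and the lower bound -/

theorem exists_mul_le_add_pow {b : ℝ} (hb : 1 < b) (α : ℝ) {γ : ℝ} (hγ : 0 < γ) :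
    ∃ M : ℝ, ∀ n : ℕ, α * n ≤ M + γ * b ^ n := by
  have h := (tendsto_pow_const_div_const_pow_of_one_lt 1 hb).const_mul α
  rw [mul_zero] at h
  obtain ⟨N, hN⟩ := Filter.eventually_atTop.1 (h.eventually (ge_mem_nhds hγ))
  refine ⟨|α| * N, fun n => ?_⟩
  have hp : 0 < b ^ n := by positivity
  rcases le_total N n with hn | hn
  · have := hN n hn
    rw [pow_one, ← mul_div_assoc, div_le_iff₀ hp] at this
    have : 0 ≤ |α| * N := by positivity
    linarith
  · have h1 : α * n ≤ |α| * n := by gcongr; exact le_abs_self α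
    have h2 : |α| * n ≤ |α| * N := by gcongr
    have : 0 ≤ γ * b ^ n := by positivity
    linarith

/-- Digit sizes `A k ≍ c ^ b ^ (k + 1)` satisfy the growth condition that yields the Hölder
exponent `t < 1 / (1 + b)`. -/
theorem exists_rpow_prod_le {b c t : ℝ} (hb : 1 < b) (hc : 1 < c) (ht : 0 < t)
    (htb : t * (1 + b) < 1) {A : ℕ → ℕ} (hA1 : ∀ k, c ^ b ^ (k + 1) ≤ (A k : ℝ))
    (hA2 : ∀ k, (A k : ℝ) ≤ 10 * c ^ b ^ (k + 1)) :
    ∃ K : ℝ, 0 < K ∧ ∀ n : ℕ,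
      ((∏ k ∈ Finset.range (n + 1), (25 * (A k : ℝ) ^ 2)) / A n) ^ t ≤
        K * ∏ k ∈ Finset.range n, (A k : ℝ) := by
  have hΛ : 0 < Real.log c := Real.log_pos hc
  have hcpos : ∀ k : ℕ, 0 < c ^ b ^ (k + 1) := fun k => Real.rpow_pos_of_pos (by linarith) _
  have hApos : ∀ k, 0 < (A k : ℝ) := fun k => (hcpos k).trans_le (hA1 k)
  have hb1 : 0 < b - 1 := by linarith
  -- This is the coefficient of b ^ n in (1 - 2t) log Q - t log (A n) after inserting the bounds on
  -- both logarithms. It is positive exactly because t (1 + b) < 1, and it absorbs the factor 25 ^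
  -- (t (n + 1)).
  have hγ : 0 < Real.log c * (b * (1 - t * (1 + b)) / (b - 1)) :=
    mul_pos hΛ (div_pos (mul_pos (by linarith) (by linarith)) hb1)
  obtain ⟨M, hM⟩ := exists_mul_le_add_pow hb (t * Real.log 25) hγ
  refine ⟨Real.exp (M + t * Real.log 25 + t * Real.log 10 +
    Real.log c * ((1 - 2 * t) * b / (b - 1))), Real.exp_pos _, fun n => ?_⟩
  set Q := ∏ k ∈ Finset.range n, (A k : ℝ) with hQ
  have hQpos : 0 < Q := Finset.prod_pos fun k _ => hApos k
  have e1 : (∏ k ∈ Finset.range (n + 1), (25 * (A k : ℝ) ^ 2)) / A n =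
      25 ^ (n + 1) * Q ^ 2 * A n := by
    rw [Finset.prod_mul_distrib, Finset.prod_const, Finset.card_range, Finset.prod_pow,
      Finset.prod_range_succ, ← hQ]
    have := (hApos n).ne'
    field_simp
  have hX : 0 < 25 ^ (n + 1) * Q ^ 2 * (A n : ℝ) := mul_pos (by positivity) (hApos n)
  rw [e1, ← Real.log_le_log_iff (Real.rpow_pos_of_pos hX _) (by positivity), Real.log_rpow hX,
    Real.log_mul (Real.exp_pos _).ne' hQpos.ne', Real.log_exp,
    Real.log_mul (by positivity) (hApos n).ne', Real.log_mul (by positivity) (by positivity),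
    Real.log_pow, Real.log_pow]
  have hlA : Real.log (A n) ≤ Real.log 10 + Real.log c * b ^ (n + 1) := by
    refine (Real.log_le_log (hApos n) (hA2 n)).trans_eq ?_
    rw [Real.log_mul (by norm_num) (hcpos n).ne', Real.log_rpow (by linarith), mul_comm (b ^ _)]
  have hlQ : Real.log c * ((b ^ (n + 1) - b) / (b - 1)) ≤ Real.log Q := by
    rw [hQ, Real.log_prod fun k _ => (hApos k).ne']
    have : (b ^ (n + 1) - b) / (b - 1) = ∑ k ∈ Finset.range n, b ^ (k + 1) := by
      rw [div_eq_iff hb1.ne', pow_succ, ← sub_one_mul, ← geom_sum_mul]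
      simp only [pow_succ, ← Finset.sum_mul]
      ring
    rw [this, Finset.mul_sum]
    refine Finset.sum_le_sum fun k _ => ?_
    rw [mul_comm, ← Real.log_rpow (by linarith)]
    exact Real.log_le_log (hcpos k) (hA1 k)
  have h2t : 0 ≤ 1 - 2 * t := by nlinarith
  have key : Real.log c * (b * (1 - t * (1 + b)) / (b - 1)) * b ^ n =
      (1 - 2 * t) * (Real.log c * ((b ^ (n + 1) - b) / (b - 1))) - t * (Real.log c * b ^ (n + 1)) +
        Real.log c * ((1 - 2 * t) * b / (b - 1)) := by
    field_simp
    ring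
  have h3 := hM n
  have h4 := mul_le_mul_of_nonneg_left hlA ht.le
  have h5 := mul_le_mul_of_nonneg_left hlQ h2t
  push_cast
  linarith

/-- The hypothesis makes g injective with a t-Hölder inverse, and such a map enlarges dimension by
at most the factor 1 / t. -/
theorem two_mul_le_dimH_image {g : ℂ → ℂ} {C t : ℝ} (ht : 0 < t) (hC : 0 ≤ C)
    (h : ∀ u ∈ unitSquare, ∀ v ∈ unitSquare, ‖u - v‖ ≤ C * ‖g u - g v‖ ^ t) :
    ENNReal.ofReal (2 * t) ≤ dimH (g '' unitSquare) := by
  have hinj : Set.InjOn g unitSquare := by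
    intro u hu v hv huv
    have := h u hu v hv
    rw [huv, sub_self, norm_zero, Real.zero_rpow ht.ne', mul_zero] at this
    exact sub_eq_zero.1 (norm_le_zero_iff.1 this)
  have hf : HolderOnWith C.toNNReal t.toNNReal (Function.invFunOn g unitSquare)
      (g '' unitSquare) := by
    rintro _ ⟨u, hu, rfl⟩ _ ⟨v, hv, rfl⟩
    rw [hinj.leftInvOn_invFunOn hu, hinj.leftInvOn_invFunOn hv, edist_dist, edist_dist,
      Real.coe_toNNReal _ ht.le, ENNReal.ofReal_rpow_of_nonneg dist_nonneg ht.le]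
    rw [← ENNReal.ofReal, ← ENNReal.ofReal_mul hC, dist_eq_norm, dist_eq_norm]
    exact ENNReal.ofReal_le_ofReal (h u hu v hv)
  have h1 := hf.dimH_image_le (Real.toNNReal_pos.2 ht)
  rw [hinj.leftInvOn_invFunOn.image_image] at h1
  have h2 : dimH unitSquare = 2 := by
    have hn : unitSquare ∈ nhds (⟨1 / 2, 1 / 2⟩ : ℂ) := by
      have ho : IsOpen {z : ℂ | (0 < z.re ∧ z.re < 1) ∧ 0 < z.im ∧ z.im < 1} :=
        ((isOpen_lt continuous_const Complex.continuous_re).inter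
          (isOpen_lt Complex.continuous_re continuous_const)).inter
          ((isOpen_lt continuous_const Complex.continuous_im).inter
          (isOpen_lt Complex.continuous_im continuous_const))
      refine Filter.mem_of_superset (ho.mem_nhds ?_) ?_
      · norm_num
      · exact fun z hz => ⟨⟨hz.1.1.le, hz.1.2⟩, hz.2.1.le, hz.2.2⟩
    rw [Real.dimH_of_mem_nhds hn, Complex.finrank_real_complex]
    rfl
  have ht0 : (t.toNNReal : ENNReal) ≠ 0 := by simpa using ht
  rw [h2, ENNReal.le_div_iff_mul_le (Or.inl ht0) (Or.inl ENNReal.coe_ne_top)] at h1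
  rwa [ENNReal.ofReal_mul (by norm_num), ENNReal.ofReal_ofNat]

theorem le_dimH_luczakAll {b c : ℝ} (hb : 1 < b) (hc : 1 < c) :
    ENNReal.ofReal (2 / (1 + b)) ≤ dimH (luczakAll supNorm b c) := by
  refine ENNReal.le_of_forall_nnreal_lt fun r hr => ?_
  rcases eq_or_ne r 0 with rfl | hr0
  · simp
  obtain ⟨t, rfl⟩ : ∃ t : ℝ, r = (2 * t).toNNReal := ⟨r / 2, by
    rw [mul_div_cancel₀ _ two_ne_zero, Real.toNNReal_coe]⟩
  have ht : 0 < t := by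
    by_contra h
    exact hr0 (Real.toNNReal_of_nonpos (by linarith))
  have htb : t * (1 + b) < 1 := by
    have := (ENNReal.ofReal_lt_ofReal_iff (by positivity)).1 hr
    rw [lt_div_iff₀ (by linarith)] at this
    linarith
  let A : ℕ → ℕ := fun k => ⌈c ^ b ^ (k + 1)⌉₊ + 8
  have hone : ∀ k : ℕ, 1 ≤ c ^ b ^ (k + 1) := fun k => Real.one_le_rpow hc.le (by positivity)
  have hA1 : ∀ k, c ^ b ^ (k + 1) ≤ (A k : ℝ) := fun k => by
    have := Nat.le_ceil (c ^ b ^ (k + 1))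
    push_cast [A]
    linarith
  have hA2 : ∀ k, (A k : ℝ) ≤ 10 * c ^ b ^ (k + 1) := fun k => by
    have := Nat.ceil_lt_add_one (zero_le_one.trans (hone k))
    have := hone k
    push_cast [A]
    linarith
  obtain ⟨g, hg, hgd⟩ := exists_map_unitSquare (A := A) fun k => by simp [A]
  obtain ⟨K, hK, hKn⟩ := exists_rpow_prod_le hb hc ht htb hA1 hA2
  have hsub : g '' unitSquare ⊆ luczakAll supNorm b c := by
    rintro _ ⟨u, hu, rfl⟩
    refine ⟨(hg u hu).1, fun n hn => ?_⟩
    obtain ⟨m, rfl⟩ : ∃ m, n = m + 1 := ⟨n - 1, by omega⟩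
    exact ⟨((hg u hu).2 m).1, (hA1 m).trans ((hg u hu).2 m).2⟩
  refine le_trans ?_ (dimH_mono hsub)
  refine two_mul_le_dimH_image (C := 6 * K) ht (by positivity) fun u hu v hv => ?_
  rcases eq_or_ne u v with rfl | huv
  · simp [Real.zero_rpow ht.ne']
  obtain ⟨n, δ, hδ, hδA, h1, h2⟩ := hgd u hu v hv huv
  have hApos : ∀ k, 0 < (A k : ℝ) := fun k => by linarith [hA1 k, hone k]
  set Q := ∏ k ∈ Finset.range n, (A k : ℝ) with hQ
  have hQpos : 0 < Q := Finset.prod_pos fun k _ => hApos k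
  set P := ∏ k ∈ Finset.range (n + 1), (25 * (A k : ℝ) ^ 2) with hP
  have hPpos : 0 < P := Finset.prod_pos fun k _ => by have := hApos k; positivity
  have hAn := hApos n
  rw [Finset.prod_range_succ, ← hQ] at h1
  -- Normalising the digit difference gives ρ ≤ 1, hence ρ ≤ ρ ^ t. One estimate then covers
  -- neighbouring and distant digits alike.
  set ρ := δ / (2 * A n) with hρ
  have hρpos : 0 < ρ := by positivity
  have hρ1 : ρ ≤ 1 := (div_le_one (by positivity)).2 hδA
  have hδρ : δ = 2 * A n * ρ := by rw [hρ]; field_simp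
  have ht1 : t ≤ 1 := by nlinarith
  have h3 : ‖u - v‖ * Q ≤ 6 * ρ := by
    rw [hδρ] at h1
    refine le_of_mul_le_mul_right ?_ hAn
    linarith
  have h4 : ρ ≤ ‖g u - g v‖ * (P / A n) := by
    rw [hδρ] at h2
    rw [← mul_div_assoc, le_div_iff₀ hAn]
    linarith
  have h5 : ρ ≤ ρ ^ t := by
    simpa using Real.rpow_le_rpow_of_exponent_ge hρpos hρ1 ht1
  have h6 : ρ ^ t ≤ ‖g u - g v‖ ^ t * (K * Q) := by
    refine (Real.rpow_le_rpow hρpos.le h4 ht.le).trans ?_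
    rw [Real.mul_rpow (norm_nonneg _) (by positivity)]
    exact mul_le_mul_of_nonneg_left (hKn n) (Real.rpow_nonneg (norm_nonneg _) _)
  refine le_of_mul_le_mul_right ?_ hQpos
  linarith

/-! ### Convergent sums and records for the upper bound -/

theorem tsum_ofReal_norm_rpow_ne_top {κ : ℝ} (hκ : 2 < κ) :
    ∑' a : GaussianInt, ENNReal.ofReal (‖GaussianInt.toComplex a‖ ^ (-κ)) ≠ ⊤ := by
  refine Summable.tsum_ofReal_ne_top ?_
  have hinj : Function.Injective fun a : GaussianInt => ![a.re, a.im] := by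
    intro a a' h
    have h0 := congrFun h 0
    have h1 := congrFun h 1
    exact Zsqrtd.ext h0 h1
  refine Summable.of_nonneg_of_le (fun a => by positivity) (fun a => ?_)
    ((EisensteinSeries.summable_one_div_norm_rpow hκ).comp_injective hinj)
  rcases eq_or_ne a 0 with rfl | ha
  -- The convention 0 ^ (-κ) = 0 makes the zero digit contribute nothing.
  · rw [map_zero, norm_zero, Real.zero_rpow (by linarith)]
    exact Real.rpow_nonneg (norm_nonneg _) _
  · refine Real.rpow_le_rpow_of_nonpos ?_ ?_ (by linarith)
    · rw [norm_pos_iff]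
      exact fun h => ha (Zsqrtd.ext (congrFun h 0) (congrFun h 1))
    · rw [pi_norm_le_iff_of_nonneg (norm_nonneg _)]
      intro i
      fin_cases i
      · simpa [Int.norm_eq_abs, GaussianInt.intCast_re] using
          Complex.abs_re_le_norm (GaussianInt.toComplex a)
      · simpa [Int.norm_eq_abs, GaussianInt.intCast_im] using
          Complex.abs_im_le_norm (GaussianInt.toComplex a)

theorem tsum_pi_prod_eq_pow {α : Type*} (f : α → ENNReal) (n : ℕ) :
    ∑' i : Fin n → α, ∏ k, f (i k) = (∑' a, f a) ^ n := by
  induction n with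
  | zero => simp
  | succ n ih =>
    rw [← (Fin.consEquiv fun _ => α).tsum_eq, ENNReal.tsum_prod', pow_succ', ← ih,
      ← ENNReal.tsum_mul_right]
    refine tsum_congr fun a => ?_
    rw [← ENNReal.tsum_mul_left]
    refine tsum_congr fun i => ?_
    rw [Fin.prod_univ_succ]
    rfl

/-- Doubly exponential decay beats any K ^ n, with room for a geometric majorant. -/
theorem tsum_pow_mul_exp_ne_top {K η β : ℝ} (hK : 0 < K) (hη : 0 < η) (hβ : 1 < β) :
    ∑' n : ℕ, ENNReal.ofReal (K ^ n * Real.exp (-(η * β ^ (n + 1)))) ≠ ⊤ := by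
  obtain ⟨M, hM⟩ := exists_mul_le_add_pow hβ (Real.log K + Real.log 2)
    (mul_pos hη (by linarith : 0 < β))
  refine Summable.tsum_ofReal_ne_top (Summable.of_nonneg_of_le (fun n => by positivity)
    (fun n => ?_) (summable_geometric_two.mul_left (Real.exp M)))
  have h1 : K ^ n = Real.exp (n * Real.log K) := by
    rw [Real.exp_nat_mul, Real.exp_log hK]
  have h2 : ((1 : ℝ) / 2) ^ n = Real.exp (-(n * Real.log 2)) := by
    rw [Real.exp_neg, Real.exp_nat_mul, Real.exp_log two_pos, one_div, inv_pow]
  rw [h1, h2, ← Real.exp_add, ← Real.exp_add]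
  refine Real.exp_le_exp.2 ?_
  have := hM n
  rw [pow_succ]
  linarith

/-- If `L` exceeds `Λ b ^ n` infinitely often, then `L n / β ^ n` has infinitely many records. -/
theorem exists_record {L : ℕ → ℝ} {b β Λ : ℝ} (hβ : 1 < β) (hβb : β < b) (hΛ : 0 < Λ)
    (hL : ∀ N, ∃ n ≥ N, Λ * b ^ n ≤ L n) (N : ℕ) :
    ∃ n ≥ N, β * L n ≤ L (n + 1) ∧ β ^ (n + 1) ≤ L (n + 1) := by
  by_contra! h
  have hβ0 : 0 < β := by linarith
  -- Without records from N on, each step has L (n + 1) < β * L n or L (n + 1) < β ^ (n + 1). Either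
  -- way L n ≤ M β ^ n persists (the second case needs M ≥ 1), and growth at rate b > β contradicts
  -- it.
  set M := max 1 (L N / β ^ N) with hM
  have hbound : ∀ n ≥ N, L n ≤ M * β ^ n := by
    intro n hn
    induction n, hn using Nat.le_induction with
    | base =>
      rw [← div_le_iff₀ (by positivity)]
      exact le_max_right _ _
    | succ n hn ih =>
      have hM1 : 1 ≤ M := le_max_left _ _
      have hp : 0 < β ^ (n + 1) := by positivity
      rcases le_or_gt (β * L n) (L (n + 1)) with h1 | h1
      · nlinarith [h n hn h1]
      · rw [pow_succ]
        nlinarith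
  obtain ⟨m, hm⟩ := pow_unbounded_of_one_lt (M / Λ) ((one_lt_div hβ0).2 hβb)
  obtain ⟨n, hn, hn'⟩ := hL (max N m)
  have h1 := hn'.trans (hbound n ((le_max_left _ _).trans hn))
  have h2 : (b / β) ^ m ≤ (b / β) ^ n :=
    pow_le_pow_right₀ ((one_lt_div hβ0).2 hβb).le ((le_max_right _ _).trans hn)
  have h3 := hm.trans_le h2
  rw [div_pow, div_lt_div_iff₀ hΛ (by positivity)] at h3
  linarith

/-! ### Digit products, record cylinders and their diameters -/

/-- The product of the absolute values of the first `n` digits. -/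
def digitProd (z : ℂ) (n : ℕ) : ℝ :=
  ∏ k ∈ Finset.range n, ‖GaussianInt.toComplex (partialQuotient z (k + 1))‖

/-- The points of `𝔉` with an infinite expansion. -/
def infiniteExpansion : Set ℂ :=
  {z | z ∈ fundamentalSquare ∧ ∀ k, gaussMap^[k] z ≠ 0}

theorem iterate_mem_fundamentalSquare {z : ℂ} (hz : z ∈ fundamentalSquare) (k : ℕ) :
    gaussMap^[k] z ∈ fundamentalSquare := by
  cases k with
  | zero => exact hz
  | succ k =>
    rw [Function.iterate_succ_apply']
    exact gaussMap_mem_fundamentalSquare _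

theorem inv_iterate_eq {z : ℂ} (hz : z ∈ infiniteExpansion) (k : ℕ) :
    (gaussMap^[k] z)⁻¹ = GaussianInt.toComplex (partialQuotient z (k + 1)) +
      gaussMap^[k + 1] z := by
  rw [partialQuotient, Nat.add_sub_cancel, Function.iterate_succ_apply']
  exact inv_eq_nearest_add_gaussMap (hz.2 k)

/-- A zero digit would leave a remainder and its inverse both of modulus at most 3/4, yet their
product is 1. -/
theorem one_le_norm_partialQuotient {z : ℂ} (hz : z ∈ infiniteExpansion) (k : ℕ) :
    1 ≤ ‖GaussianInt.toComplex (partialQuotient z (k + 1))‖ := by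
  refine one_le_norm_toComplex fun h => ?_
  have h1 := inv_iterate_eq hz k
  rw [h, map_zero, zero_add] at h1
  have h2 := norm_le_of_mem_fundamentalSquare (iterate_mem_fundamentalSquare hz.1 (k + 1))
  have h3 := norm_le_of_mem_fundamentalSquare (iterate_mem_fundamentalSquare hz.1 k)
  have h4 : ‖gaussMap^[k] z‖ * ‖(gaussMap^[k] z)⁻¹‖ = 1 := by
    rw [← norm_mul, mul_inv_cancel₀ (hz.2 k), norm_one]
  rw [h1] at h4
  nlinarith [norm_nonneg (gaussMap^[k] z), norm_nonneg (gaussMap^[k + 1] z)]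

theorem norm_iterate_mul_le {z : ℂ} (hz : z ∈ infiniteExpansion) (k : ℕ) :
    ‖gaussMap^[k] z‖ * ‖GaussianInt.toComplex (partialQuotient z (k + 1))‖ ≤ 4 := by
  have h1 := one_le_norm_partialQuotient hz k
  have h2 := norm_le_of_mem_fundamentalSquare (iterate_mem_fundamentalSquare hz.1 (k + 1))
  have h4 : ‖gaussMap^[k] z‖ * ‖(gaussMap^[k] z)⁻¹‖ = 1 := by
    rw [← norm_mul, mul_inv_cancel₀ (hz.2 k), norm_one]
  -- The next remainder is at most 3/4, and the digit has modulus at least 1, so subtracting 3/4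
  -- leaves at least a quarter of it.
  have h5 : ‖GaussianInt.toComplex (partialQuotient z (k + 1))‖ ≤ 4 * ‖(gaussMap^[k] z)⁻¹‖ := by
    have := norm_sub_le (GaussianInt.toComplex (partialQuotient z (k + 1)) + gaussMap^[k + 1] z)
      (gaussMap^[k + 1] z)
    rw [add_sub_cancel_right, ← inv_iterate_eq hz k] at this
    linarith
  nlinarith [norm_nonneg (gaussMap^[k] z)]

theorem one_le_digitProd {z : ℂ} (hz : z ∈ infiniteExpansion) (n : ℕ) : 1 ≤ digitProd z n :=
  Finset.one_le_prod fun k _ => one_le_norm_partialQuotient hz k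

/-- The points whose first `n` digits are `i` and whose next digit is exceptionally large. -/
def recordCylinder (β : ℝ) (n : ℕ) (i : Fin n → GaussianInt) : Set ℂ :=
  {z | z ∈ infiniteExpansion ∧ (∀ k : Fin n, partialQuotient z (k + 1) = i k) ∧
    digitProd z n ^ β ≤ digitProd z (n + 1) ∧ Real.exp (β ^ (n + 1)) ≤ digitProd z (n + 1)}

/-- The two record conditions are interpolated with weights γ/β and 1 - γ/β: the first keeps a power
of the digit product, the second supplies the decay. The remainder is of the order of the inverse of
the next digit. -/
theorem norm_iterate_le_of_mem_recordCylinder {β γ : ℝ} (hγ : 0 < γ) (hγβ : γ < β) {n : ℕ}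
    {i : Fin n → GaussianInt} {z : ℂ} (hz : z ∈ recordCylinder β n i) :
    ‖gaussMap^[n] z‖ ≤
      4 * (digitProd z n ^ (1 - γ) * Real.exp (-((1 - γ / β) * β ^ (n + 1)))) := by
  obtain ⟨hz1, -, hz3, hz4⟩ := hz
  have hβ : 0 < β := hγ.trans hγβ
  have hP : 0 < digitProd z n := zero_lt_one.trans_le (one_le_digitProd hz1 n)
  have hP' : 0 < digitProd z (n + 1) := zero_lt_one.trans_le (one_le_digitProd hz1 (n + 1))
  have hθ : 0 ≤ 1 - γ / β := sub_nonneg.2 ((div_le_one hβ).2 hγβ.le)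
  have h1 : digitProd z n ^ γ * Real.exp ((1 - γ / β) * β ^ (n + 1)) ≤ digitProd z (n + 1) := by
    calc _ = (digitProd z n ^ β) ^ (γ / β) * Real.exp (β ^ (n + 1)) ^ (1 - γ / β) := by
          rw [← Real.rpow_mul hP.le, mul_div_cancel₀ _ hβ.ne', ← Real.exp_mul,
            mul_comm (1 - γ / β)]
      _ ≤ digitProd z (n + 1) ^ (γ / β) * digitProd z (n + 1) ^ (1 - γ / β) := by
          gcongr
      _ = _ := by rw [← Real.rpow_add hP', add_sub_cancel, Real.rpow_one]
  have h2 := norm_iterate_mul_le hz1 n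
  have h3 : digitProd z (n + 1) =
      digitProd z n * ‖GaussianInt.toComplex (partialQuotient z (n + 1))‖ :=
    Finset.prod_range_succ _ _
  have hX : 0 < digitProd z n ^ γ * Real.exp ((1 - γ / β) * β ^ (n + 1)) := by positivity
  rw [Real.exp_neg, Real.rpow_sub hP, Real.rpow_one, ← div_eq_mul_inv, div_div, ← mul_div_assoc,
    le_div_iff₀ hX]
  calc _ ≤ ‖gaussMap^[n] z‖ * digitProd z (n + 1) := by gcongr
    _ = digitProd z n *
        (‖gaussMap^[n] z‖ * ‖GaussianInt.toComplex (partialQuotient z (n + 1))‖) := by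
          rw [h3]; ring
    _ ≤ digitProd z n * 4 := by gcongr
    _ = _ := mul_comm _ _

theorem digitProd_eq {z : ℂ} {n : ℕ} {i : Fin n → GaussianInt}
    (h : ∀ k : Fin n, partialQuotient z (k + 1) = i k) :
    digitProd z n = ∏ k, ‖GaussianInt.toComplex (i k)‖ := by
  rw [digitProd, ← Fin.prod_univ_eq_prod_range
    (fun k => ‖GaussianInt.toComplex (partialQuotient z (k + 1))‖)]
  simp_rw [h]

/-- The n shared digits contribute at most 16 ^ n / P², and the two n-th remainders together at most
8 P ^ (1 - γ) E. -/
theorem norm_sub_le_of_mem_recordCylinder {β γ : ℝ} (hγ : 0 < γ) (hγβ : γ < β) {n : ℕ}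
    {i : Fin n → GaussianInt} {z w : ℂ} (hz : z ∈ recordCylinder β n i)
    (hw : w ∈ recordCylinder β n i) :
    ‖z - w‖ ≤ 8 * 16 ^ n * Real.exp (-((1 - γ / β) * β ^ (n + 1))) *
      (∏ k, ‖GaussianInt.toComplex (i k)‖) ^ (-(1 + γ)) := by
  have hPz := digitProd_eq hz.2.1
  have hPw := digitProd_eq hw.2.1
  have hzn := norm_iterate_le_of_mem_recordCylinder hγ hγβ hz
  have hwn := norm_iterate_le_of_mem_recordCylinder hγ hγβ hw
  rw [hPz] at hzn
  rw [hPw] at hwn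
  have hP1 := one_le_digitProd hz.1 n
  have hpq : ∀ k < n, partialQuotient z (k + 1) = partialQuotient w (k + 1) := fun k hk =>
    (hz.2.1 ⟨k, hk⟩).trans (hw.2.1 ⟨k, hk⟩).symm
  have e1 := norm_sub_eq_mul_prod (x := fun k => gaussMap^[k] z) (y := fun k => gaussMap^[k] w)
      (n := n) (a := fun k => GaussianInt.toComplex (partialQuotient z (k + 1)))
      (fun k _ => hz.1.2 k) (fun k _ => hw.1.2 k) (fun k _ => inv_iterate_eq hz.1 k)
      (fun k hk => by simp only [hpq k hk]; exact inv_iterate_eq hw.1 k)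
  have e2 : (∏ k ∈ Finset.range n, (‖gaussMap^[k] z‖ * ‖gaussMap^[k] w‖)) * digitProd z n ^ 2 ≤
      16 ^ n := by
    rw [digitProd, ← Finset.prod_pow, ← Finset.prod_mul_distrib]
    refine (Finset.prod_le_prod (g := fun _ => (16 : ℝ)) (fun k _ => by positivity)
      fun k hk => ?_).trans_eq (by simp)
    have h1 := norm_iterate_mul_le hz.1 k
    have h2 := norm_iterate_mul_le hw.1 k
    rw [← hpq k (Finset.mem_range.1 hk)] at h2
    calc _ = (‖gaussMap^[k] z‖ * ‖GaussianInt.toComplex (partialQuotient z (k + 1))‖) *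
          (‖gaussMap^[k] w‖ * ‖GaussianInt.toComplex (partialQuotient z (k + 1))‖) := by ring
      _ ≤ 4 * 4 := by gcongr
      _ = 16 := by norm_num
  rw [hPz] at hP1 e2
  set P := ∏ k, ‖GaussianInt.toComplex (i k)‖
  set E := Real.exp (-((1 - γ / β) * β ^ (n + 1)))
  have hP : 0 < P := by linarith
  have e3 : P ^ (-(1 + γ)) = P ^ (1 - γ) / P ^ 2 := by
    rw [← Real.rpow_natCast, ← Real.rpow_sub hP]
    congr 1
    push_cast
    ring
  simp only [Function.iterate_zero, id_eq] at e1
  rw [e1, e3, ← mul_div_assoc, le_div_iff₀ (by positivity), mul_assoc]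
  calc _ ≤ (8 * (P ^ (1 - γ) * E)) * 16 ^ n := by
        refine mul_le_mul ?_ e2 (by positivity) (by positivity)
        refine (norm_sub_le _ _).trans ?_
        linarith
    _ = _ := by ring

theorem ediam_recordCylinder_le {β γ : ℝ} (hγ : 0 < γ) (hγβ : γ < β) (n : ℕ)
    (i : Fin n → GaussianInt) :
    Metric.ediam (recordCylinder β n i) ≤
      ENNReal.ofReal (8 * 16 ^ n * Real.exp (-((1 - γ / β) * β ^ (n + 1))) *
        (∏ k, ‖GaussianInt.toComplex (i k)‖) ^ (-(1 + γ))) := by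
  refine Metric.ediam_le fun z hz w hw => ?_
  rw [edist_dist, dist_eq_norm]
  exact ENNReal.ofReal_le_ofReal (norm_sub_le_of_mem_recordCylinder hγ hγβ hz hw)

/-- A bound uniform in the digit string, needed for the mesh of the covers to tend to 0. -/
theorem ediam_recordCylinder_le' {β γ : ℝ} (hγ : 0 < γ) (hγβ : γ < β) (n : ℕ)
    (i : Fin n → GaussianInt) :
    Metric.ediam (recordCylinder β n i) ≤
      8 * ENNReal.ofReal (16 ^ n * Real.exp (-((1 - γ / β) * β ^ (n + 1)))) := by
  rcases (recordCylinder β n i).eq_empty_or_nonempty with h | ⟨z, hz⟩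
  · rw [h, Metric.ediam_empty]
    exact zero_le
  · refine (ediam_recordCylinder_le hγ hγβ n i).trans ?_
    rw [← ENNReal.ofReal_ofNat 8, ← ENNReal.ofReal_mul (by norm_num), ← mul_assoc]
    refine ENNReal.ofReal_le_ofReal (mul_le_of_le_one_right (by positivity) ?_)
    rw [← digitProd_eq hz.2.1]
    exact Real.rpow_le_one_of_one_le_of_nonpos (one_le_digitProd hz.1 n) (by linarith)

theorem tsum_ediam_recordCylinder_rpow_le {β γ s : ℝ} (hγ : 0 < γ) (hγβ : γ < β) (hs : 0 < s)
    (n : ℕ) :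
    ∑' i : Fin n → GaussianInt, Metric.ediam (recordCylinder β n i) ^ s ≤
      ENNReal.ofReal ((8 * 16 ^ n * Real.exp (-((1 - γ / β) * β ^ (n + 1)))) ^ s) *
        (∑' a : GaussianInt, ENNReal.ofReal (‖GaussianInt.toComplex a‖ ^ (-((1 + γ) * s)))) ^ n := by
  rw [← tsum_pi_prod_eq_pow, ← ENNReal.tsum_mul_left]
  refine ENNReal.tsum_le_tsum fun i => ?_
  refine (ENNReal.rpow_le_rpow (ediam_recordCylinder_le hγ hγβ n i) hs.le).trans_eq ?_
  have hP : 0 ≤ ∏ k, ‖GaussianInt.toComplex (i k)‖ := Finset.prod_nonneg fun _ _ => norm_nonneg _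
  rw [ENNReal.ofReal_rpow_of_nonneg (by positivity) hs.le, Real.mul_rpow (by positivity)
    (by positivity), ENNReal.ofReal_mul (by positivity), ← Real.rpow_mul hP, neg_mul,
    ← Real.finsetProd_rpow _ _ fun _ _ => norm_nonneg _,
    ENNReal.ofReal_prod_of_nonneg fun _ _ => by positivity]

theorem exists_mem_recordCylinder {b c β : ℝ} (hc : 1 < c) (hβ : 1 < β) (hβb : β < b) {z : ℂ}
    (hz : z ∈ luczakInfinitelyOften (fun z => ‖z‖) b c) (N : ℕ) :
    ∃ n ≥ N, ∃ i, z ∈ recordCylinder β n i := by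
  obtain ⟨hz1, hz2⟩ := hz
  have hinf : z ∈ infiniteExpansion := by
    -- The Gauss map fixes 0, so a terminated expansion has only finitely many partial quotients.
    refine ⟨hz1, fun k hk => ?_⟩
    obtain ⟨n, ⟨⟨-, hn⟩, -⟩, hkn⟩ := hz2.exists_gt k
    obtain ⟨m, hm⟩ : ∃ m, n - 1 = m + k := ⟨n - 1 - k, by omega⟩
    rw [hm, Function.iterate_add_apply, hk] at hn
    refine hn (Function.iterate_fixed ?_ m)
    simp [gaussMap]
  have hP : ∀ n, 1 ≤ digitProd z n := one_le_digitProd hinf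
  obtain ⟨n, hn, h1, h2⟩ := exists_record (L := fun n => Real.log (digitProd z n)) hβ hβb
    (Real.log_pos hc) (fun N => by
      obtain ⟨n, ⟨⟨hn1, -⟩, hn⟩, hNn⟩ := hz2.exists_gt N
      refine ⟨n, hNn.le, ?_⟩
      obtain ⟨m, rfl⟩ : ∃ m, n = m + 1 := ⟨n - 1, by omega⟩
      have h0 : 0 < c ^ b ^ (m + 1) := Real.rpow_pos_of_pos (by linarith) _
      rw [mul_comm, ← Real.log_rpow (by linarith)]
      refine Real.log_le_log h0 (hn.trans ?_)
      rw [digitProd, Finset.prod_range_succ]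
      exact le_mul_of_one_le_left (norm_nonneg _) (hP m)) N
  refine ⟨n, hn, fun k => partialQuotient z (k + 1), hinf, fun _ => rfl, ?_, ?_⟩
  · have h0 : 0 < digitProd z n := zero_lt_one.trans_le (hP n)
    rw [← Real.log_le_log_iff (by positivity) (zero_lt_one.trans_le (hP _)), Real.log_rpow h0]
    exact h1
  · rw [← Real.le_log_iff_exp_le (zero_lt_one.trans_le (hP _))]
    exact h2

theorem hausdorffMeasure_luczakInfinitelyOften {b c s : ℝ} (hb : 1 < b) (hc : 1 < c)
    (hs : 2 / (1 + b) < s) :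
    MeasureTheory.Measure.hausdorffMeasure s (luczakInfinitelyOften (fun z => ‖z‖) b c) = 0 := by
  have hs0 : 0 < s := lt_trans (by positivity) hs
  -- The condition γ > 2 / s - 1 is (1 + γ) s > 2, compatible with γ < b because s > 2 / (1 + b).
  obtain ⟨γ, hγ, hγb⟩ := exists_between (max_lt hb (show 2 / s - 1 < b by
    rw [div_lt_iff₀ (by linarith)] at hs
    rw [sub_lt_iff_lt_add, div_lt_iff₀ hs0]
    linarith))
  obtain ⟨β, hγβ, hβb⟩ := exists_between hγb
  have hγ1 : 1 < γ := (le_max_left _ _).trans_lt hγ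
  have hγ0 : 0 < γ := by linarith
  have hβ : 1 < β := hγ1.trans hγβ
  have hκ : 2 < (1 + γ) * s := by
    have := (le_max_right _ _).trans_lt hγ
    rw [sub_lt_iff_lt_add, div_lt_iff₀ hs0] at this
    linarith
  have hθ : 0 < 1 - γ / β := sub_pos.2 ((div_lt_one (by linarith)).2 hγβ)
  have hsum := tsum_ofReal_norm_rpow_ne_top hκ
  set S := ∑' a : GaussianInt, ENNReal.ofReal (‖GaussianInt.toComplex a‖ ^ (-((1 + γ) * s)))
  set D : ℕ → ENNReal := fun n =>
    8 * ENNReal.ofReal (16 ^ n * Real.exp (-((1 - γ / β) * β ^ (n + 1))))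
  have hD : ∑' n, D n ≠ ⊤ := by
    rw [ENNReal.tsum_mul_left]
    exact ENNReal.mul_ne_top (by norm_num) (tsum_pow_mul_exp_ne_top (by norm_num) hθ hβ)
  set G : ℕ → ENNReal := fun n =>
    ENNReal.ofReal ((8 * 16 ^ n * Real.exp (-((1 - γ / β) * β ^ (n + 1)))) ^ s) * S ^ n
  have hG : ∑' n, G n ≠ ⊤ := by
    have h16 : (0 : ℝ) < 16 ^ s := by positivity
    refine ne_top_of_le_ne_top (ENNReal.mul_ne_top (ENNReal.ofReal_ne_top (r := 8 ^ s))
      (tsum_pow_mul_exp_ne_top (K := 16 ^ s * (S.toReal + 1)) (η := (1 - γ / β) * s)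
      (by positivity) (by positivity) hβ)) ?_
    rw [← ENNReal.tsum_mul_left]
    refine ENNReal.tsum_le_tsum fun n => ?_
    have hS : S ≤ ENNReal.ofReal (S.toReal + 1) := by
      conv_lhs => rw [← ENNReal.ofReal_toReal hsum]
      exact ENNReal.ofReal_le_ofReal (by linarith)
    refine (mul_le_mul_right (pow_le_pow_left₀ zero_le hS n) _).trans_eq ?_
    rw [← ENNReal.ofReal_pow (by positivity), ← ENNReal.ofReal_mul (by positivity),
      ← ENNReal.ofReal_mul (by positivity)]
    congr 1
    rw [Real.mul_rpow (by positivity) (by positivity), Real.mul_rpow (by positivity)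
      (by positivity), ← Real.exp_mul, mul_pow, Real.rpow_pow_comm (by norm_num)]
    rw [show -((1 - γ / β) * β ^ (n + 1)) * s = -((1 - γ / β) * s * β ^ (n + 1)) by ring]
    ring
  have : Countable GaussianInt := Function.Injective.countable
    (f := fun a : GaussianInt => (a.re, a.im)) fun a a' h =>
      Zsqrtd.ext (congrArg Prod.fst h) (congrArg Prod.snd h)
  rw [← nonpos_iff_eq_zero]
  -- The N-th cover consists of all record cylinders of depth at least N. The tail sums of `D` bound
  -- the mesh and those of `G` the s-dimensional sums; both tend to 0.
  refine (MeasureTheory.Measure.hausdorffMeasure_le_liminf_tsum (l := Filter.atTop)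
    (ι := fun N : ℕ => Σ m : ℕ, Fin (m + N) → GaussianInt) s _ (fun N => ∑' m, D (m + N))
    (ENNReal.tendsto_sum_nat_add D hD) (fun N p => recordCylinder β (p.1 + N) p.2)
    (Filter.Eventually.of_forall fun N p => ?_) (Filter.Eventually.of_forall fun N z hz => ?_)).trans
    ?_
  · exact (ediam_recordCylinder_le' hγ0 hγβ _ _).trans (ENNReal.le_tsum (f := fun m => D (m + N)) p.1)
  · obtain ⟨n, hn, i, hi⟩ := exists_mem_recordCylinder hc hβ hβb hz N
    obtain ⟨m, rfl⟩ : ∃ m, n = m + N := ⟨n - N, by omega⟩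
    exact Set.mem_iUnion.2 ⟨⟨m, i⟩, hi⟩
  · rw [← (ENNReal.tendsto_sum_nat_add G hG).liminf_eq]
    refine Filter.liminf_le_liminf (Filter.Eventually.of_forall fun N => ?_)
    rw [ENNReal.tsum_sigma']
    exact ENNReal.tsum_le_tsum fun m => tsum_ediam_recordCylinder_rpow_le hγ0 hγβ hs0 (m + N)

theorem dimH_luczakInfinitelyOften_le {b c : ℝ} (hb : 1 < b) (hc : 1 < c) :
    dimH (luczakInfinitelyOften (fun z => ‖z‖) b c) ≤ ENNReal.ofReal (2 / (1 + b)) := by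
  refine le_of_forall_gt_imp_ge_of_dense fun r hr => ?_
  induction r using ENNReal.recTopCoe with
  | top => exact le_top
  | coe r =>
    refine dimH_le_of_hausdorffMeasure_ne_top ?_
    rw [hausdorffMeasure_luczakInfinitelyOften hb hc]
    · exact ENNReal.zero_ne_top
    · rwa [ENNReal.ofReal_lt_coe_iff (by positivity)] at hr

/-! ### Comparison of the four sets -/

theorem luczakAll_subset_luczakInfinitelyOften (N : ℂ → ℝ) (b c : ℝ) :
    luczakAll N b c ⊆ luczakInfinitelyOften N b c := fun _ hz =>
  ⟨hz.1, (Set.Ici_infinite 1).mono fun n hn => hz.2 n hn⟩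

theorem luczakAll_mono {N N' : ℂ → ℝ} (h : ∀ z, N z ≤ N' z) (b c : ℝ) :
    luczakAll N b c ⊆ luczakAll N' b c := fun _ hz =>
  ⟨hz.1, fun n hn => ⟨(hz.2 n hn).1, (hz.2 n hn).2.trans (h _)⟩⟩

theorem luczakInfinitelyOften_mono {N N' : ℂ → ℝ} (h : ∀ z, N z ≤ N' z) (b c : ℝ) :
    luczakInfinitelyOften N b c ⊆ luczakInfinitelyOften N' b c := fun _ hz =>
  ⟨hz.1, hz.2.mono fun _ hn => ⟨hn.1, hn.2.trans (h _)⟩⟩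

end

end HurwitzCF

theorem mainTheorem3 (b c : ℝ) (hb : 1 < b) (hc : 1 < c) :
    (dimH (HurwitzCF.luczakAll (fun z : ℂ => ‖z‖) b c) = ENNReal.ofReal (2 / (1 + b)) ∧
      dimH (HurwitzCF.luczakInfinitelyOften (fun z : ℂ => ‖z‖) b c) =
        ENNReal.ofReal (2 / (1 + b))) ∧
    (dimH (HurwitzCF.luczakAll HurwitzCF.supNorm b c) = ENNReal.ofReal (2 / (1 + b)) ∧
      dimH (HurwitzCF.luczakInfinitelyOften HurwitzCF.supNorm b c) =
        ENNReal.ofReal (2 / (1 + b))) := by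
  have hlow := HurwitzCF.le_dimH_luczakAll hb hc
  have hup := HurwitzCF.dimH_luczakInfinitelyOften_le hb hc
  have h1 := dimH_mono (HurwitzCF.luczakAll_mono HurwitzCF.supNorm_le_norm b c)
  have h2 := dimH_mono (HurwitzCF.luczakInfinitelyOften_mono HurwitzCF.supNorm_le_norm b c)
  have h3 := dimH_mono (HurwitzCF.luczakAll_subset_luczakInfinitelyOften (fun z => ‖z‖) b c)
  have h4 := dimH_mono (HurwitzCF.luczakAll_subset_luczakInfinitelyOften HurwitzCF.supNorm b c)
  exact ⟨⟨le_antisymm (h3.trans hup) (hlow.trans h1), le_antisymm hup ((hlow.trans h1).trans h3)⟩,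
    le_antisymm ((h1.trans h3).trans hup) hlow, le_antisymm (h2.trans hup) (hlow.trans h4)⟩
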